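/- All objects are real and smooth. Let $(M,\circ,e,E)$ be an $n$-dimensional regular F-manifold with Euler vector field: $\circ$ is a commutative associative product on vector fields with unit $e$ satisfying the Hertling--Manin condition $\mathcal L_{X\circ Y}\circ=X\circ(\mathcal L_Y\circ)+Y\circ(\mathcal L_X\circ)$, the vector field $E$ satisfies $\mathcal L_E\circ=\circ$, and at every point the endomorphism $E\circ$ has exactly one Jordan block for each distinct eigenvalue. Let $U\subseteq M$ be an open set that is the domain of local coordinates $(u^1,\dots,u^n)$, in which $\circ$ has structure functions $c^i_{jk}$, and on which there are canonical (David--Hertling) coordinates $u^{i(\alpha)}$, $1\le\alpha\le r$, $1\le i\le m_\alpha$ (with $m_\alpha\ge 1$), i.e. coordinates in which $c^{i(\alpha)}_{j(\beta)k(\gamma)}=\delta^\alpha_\beta\delta^\alpha_\gamma\delta^i_{j+k-1}$, $e^{i(\alpha)}=\delta^i_1$ and $E^{i(\alpha)}=u^{i(\alpha)}$. For a vector field $X$, let $X\circ$ denote the $(1,1)$-tensor $V^i_k=c^i_{jk}X^j$, and for a connection $\nabla$ put $(d_\nabla V)^i_{jk}=\nabla_jV^i_k-\nabla_kV^i_j$.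 Let $X_{(1)},\dots,X_{(n)}$ be vector fields on $U$, linearly independent at every point of $U$, whose flows $$u^i_{t_k}=(X_{(k)}\circ u_x)^i=c^i_{jl}(u)\,X_{(k)}^j(u)\,u^l_x,\qquad i=1,\dots,n,$$ pairwise commute (i.e. $u_{t_kt_l}=u_{t_lt_k}$ identically in $u,u_x,u_{xx}$). Suppose that for some $X\in\{X_{(1)},\dots,X_{(n)}\}$ the components in the canonical coordinates satisfy, everywhere on $U$, $X^{1(\alpha)}\ne X^{1(\beta)}$ for $\alpha\neq\beta$, and $X^{2(\alpha)}\neq 0$ for each $\alpha$ with $m_\alpha\ge2$. Then there is a unique torsionless connection $\nabla$ on $U$ with $\nabla e=0$ and $d_\nabla(X\circ)=0$, and for every smooth function $h$ on $U$ the following are equivalent: 1. $h$ is a density of conservation laws for each of the flows $u_{t_k}=X_{(k)}\circ u_x$ on $U$, and for every flow $u_t=Y\circ u_x$ defined by a vector field $Y$ on an open set $W\subseteq U$ with $d_\nabla(Y\circ)=0$ on $W$; 2. on $U$, in the coordinates $(u^1,\dots,u^n)$, $$c^s_{kj}\nabla_s dh_i=c^s_{ij}\nabla_s dh_k\qquad\text{for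 all } i,j,k,$$ where $\nabla_s dh_i=\partial_s\partial_i h-\Gamma^t_{si}\partial_t h$. Here $h$ is a density of conservation laws for $u_t=Y\circ u_x$ on $W$ if, in a neighbourhood in $W$ of every point of $W$, the expression $h_t=\partial_i h\,(Y\circ u_x)^i$ is a total $x$-derivative of a smooth function of $u$ and finitely many of the derivatives $u_x,u_{xx},\dots$, identically in $u,u_x,u_{xx},\dots$. -/

import Mathlib

open scoped ContDiff

noncomputable section

namespace RegularF

/-! Everything is written in (arbitrary) local coordinates `u = (u^1, …, u^n)` of an `n`-dimensional
manifold, on an open coordinate domain `U`; tangent vectors are given by their components. -/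

/-- Structure functions of a product on vector fields: `c u i j k` is `c^i_{jk}(u)`. -/
abbrev StructureFunctions (n : ℕ) := (Fin n → ℝ) → Fin n → Fin n → Fin n → ℝ

/-- Christoffel symbols of a connection: `Γ u i j k` is `Γ^i_{jk}(u)`. -/
abbrev Christoffel (n : ℕ) := (Fin n → ℝ) → Fin n → Fin n → Fin n → ℝ

/-- Vector fields, through their components. -/
abbrev VField (n : ℕ) := (Fin n → ℝ) → Fin n → ℝ

variable {n : ℕ}

/-- The partial derivative `∂_i f` at `u`. -/
def pd (i : Fin n) (f : (Fin n → ℝ) → ℝ) (u : Fin n → ℝ) : ℝ :=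
  fderiv ℝ f u (Pi.single i 1)

/-- The product `a ∘ b` of two tangent vectors at `u`: `(a ∘ b)^i = c^i_{jk} a^j b^k`. -/
def tmul (c : StructureFunctions n) (u a b : Fin n → ℝ) : Fin n → ℝ :=
  fun i => ∑ j, ∑ k, c u i j k * a j * b k

/-- The product `X ∘ Y` of two vector fields. -/
def vmul (c : StructureFunctions n) (X Y : VField n) : VField n :=
  fun u => tmul c u (X u) (Y u)

/-- The Lie derivative of the product along `Z`, evaluated on the vector fields `A`, `B`:
`(L_Z ∘)(A, B) = [Z, A ∘ B] - [Z, A] ∘ B - A ∘ [Z, B]`. -/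
def lieProd (c : StructureFunctions n) (Z A B : VField n) : VField n := fun u =>
  VectorField.lieBracket ℝ Z (vmul c A B) u
    - tmul c u (VectorField.lieBracket ℝ Z A u) (B u)
    - tmul c u (A u) (VectorField.lieBracket ℝ Z B u)

/-- `(U, ∘, e)` is an F-manifold: `∘` is a smooth commutative associative product on vector fields
satisfying the Hertling–Manin condition, and the vector field `e` is its unit. -/
structure IsFManifold (U : Set (Fin n → ℝ)) (c : StructureFunctions n) (e : VField n) : Prop where
  smooth_prod : ∀ i j k, ContDiffOn ℝ ∞ (fun u => c u i j k) U
  smooth_unit : ContDiffOn ℝ ∞ e U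
  comm : ∀ u ∈ U, ∀ a b, tmul c u a b = tmul c u b a
  assoc : ∀ u ∈ U, ∀ a b d, tmul c u (tmul c u a b) d = tmul c u a (tmul c u b d)
  unit : ∀ u ∈ U, ∀ a, tmul c u (e u) a = a
  hertlingManin : ∀ X Y A B : VField n, ContDiffOn ℝ ∞ X U → ContDiffOn ℝ ∞ Y U →
    ContDiffOn ℝ ∞ A U → ContDiffOn ℝ ∞ B U → ∀ u ∈ U,
      lieProd c (vmul c X Y) A B u
        = tmul c u (X u) (lieProd c Y A B u) + tmul c u (Y u) (lieProd c X A B u)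

/-- `E` is an Euler vector field: `L_E ∘ = ∘`. -/
structure IsEulerField (U : Set (Fin n → ℝ)) (c : StructureFunctions n) (E : VField n) : Prop where
  smooth : ContDiffOn ℝ ∞ E U
  euler : ∀ A B : VField n, ContDiffOn ℝ ∞ A U → ContDiffOn ℝ ∞ B U → ∀ u ∈ U,
    lieProd c E A B u = vmul c A B u

/-- The matrix `V = X ∘` of multiplication by a vector field, `V^i_k = c^i_{jk} X^j`. -/
def mulMatrix (c : StructureFunctions n) (X : VField n) (u : Fin n → ℝ) :
    Matrix (Fin n) (Fin n) ℝ :=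
  Matrix.of fun i k => ∑ j, c u i j k * X u j

/-- A real square matrix has exactly one Jordan block for each distinct (complex) eigenvalue: the
number of Jordan blocks of an eigenvalue is the dimension of its eigenspace. -/
def OneJordanBlockPerEigenvalue (A : Matrix (Fin n) (Fin n) ℝ) : Prop :=
  ∀ μ : ℂ, Module.End.HasEigenvalue (Matrix.toLin' (A.map (algebraMap ℝ ℂ))) μ →
    Module.finrank ℂ (Module.End.eigenspace (Matrix.toLin' (A.map (algebraMap ℝ ℂ))) μ) = 1

/-- `(U, ∘, e, E)` is a regular F-manifold with Euler vector field. -/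
structure IsRegularFManifold (U : Set (Fin n → ℝ)) (c : StructureFunctions n) (e E : VField n) :
    Prop where
  fManifold : IsFManifold U c e
  euler : IsEulerField U c E
  regular : ∀ u ∈ U, OneJordanBlockPerEigenvalue (mulMatrix c E u)

/-- Double indices `i(α)`: the pair of a block `α` and a position in the block.  Positions are
counted from `0`, so `⟨α, 0⟩` is `1(α)` and `⟨α, 1⟩` is `2(α)`. -/
abbrev BlockIndex {r : ℕ} (m : Fin r → ℕ) := (α : Fin r) × Fin (m α)

/-- The canonical structure constants `δ^α_β δ^α_γ δ^i_{j+k-1}` (positions counted from `0`). -/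
def canonicalC {r : ℕ} {m : Fin r → ℕ} (I J K : BlockIndex m) : ℝ :=
  if I.1 = J.1 ∧ I.1 = K.1 ∧ (I.2 : ℕ) = (J.2 : ℕ) + (K.2 : ℕ) then 1 else 0

/-- The component with double index `I`, in the coordinates `φ`, of the tangent vector `a` at `u`. -/
def canonComp {r : ℕ} {m : Fin r → ℕ} (φ : (Fin n → ℝ) → BlockIndex m → ℝ) (u a : Fin n → ℝ)
    (I : BlockIndex m) : ℝ :=
  fderiv ℝ φ u a I

/-- `φ = (u^{i(α)})` are canonical (David–Hertling) coordinates on `U`, with blocks of sizes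
`m_1, …, m_r`: a coordinate system (smooth, injective, with invertible differential) in which
`c^{i(α)}_{j(β)k(γ)} = δ^α_β δ^α_γ δ^i_{j+k-1}`, `e^{i(α)} = δ^i_1` and `E^{i(α)} = u^{i(α)}`. -/
structure IsCanonicalCoordinates (U : Set (Fin n → ℝ)) (c : StructureFunctions n) (e E : VField n)
    {r : ℕ} (m : Fin r → ℕ) (φ : (Fin n → ℝ) → BlockIndex m → ℝ) : Prop where
  smooth : ContDiffOn ℝ ∞ φ U
  injOn : Set.InjOn φ U
  bijective : ∀ u ∈ U, Function.Bijective (fderiv ℝ φ u)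
  prod_comp : ∀ u ∈ U, ∀ a b I, canonComp φ u (tmul c u a b) I
    = ∑ J, ∑ K, canonicalC I J K * canonComp φ u a J * canonComp φ u b K
  unit_comp : ∀ u ∈ U, ∀ I, canonComp φ u (e u) I = if (I.2 : ℕ) = 0 then 1 else 0
  euler_comp : ∀ u ∈ U, ∀ I, canonComp φ u (E u) I = φ u I

/-- `∇_j Y^i = ∂_j Y^i + Γ^i_{js} Y^s`. -/
def covVec (Γ : Christoffel n) (Y : VField n) (j i : Fin n) (u : Fin n → ℝ) : ℝ :=
  pd j (fun w => Y w i) u + ∑ s, Γ u i j s * Y u s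

/-- `∇_j V^i_k = ∂_j V^i_k + Γ^i_{js} V^s_k - Γ^s_{jk} V^i_s`. -/
def covEnd (Γ : Christoffel n) (V : (Fin n → ℝ) → Matrix (Fin n) (Fin n) ℝ) (j i k : Fin n)
    (u : Fin n → ℝ) : ℝ :=
  pd j (fun w => V w i k) u + ∑ s, Γ u i j s * V u s k - ∑ s, Γ u s j k * V u i s

/-- `(d_∇ V)^i_{jk} = ∇_j V^i_k - ∇_k V^i_j`. -/
def dNabla (Γ : Christoffel n) (V : (Fin n → ℝ) → Matrix (Fin n) (Fin n) ℝ) (i j k : Fin n)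
    (u : Fin n → ℝ) : ℝ :=
  covEnd Γ V j i k u - covEnd Γ V k i j u

/-- `∇_s dh_i = ∂_s ∂_i h - Γ^t_{si} ∂_t h`. -/
def covDiff (Γ : Christoffel n) (h : (Fin n → ℝ) → ℝ) (s i : Fin n) (u : Fin n → ℝ) : ℝ :=
  pd s (fun w => pd i h w) u - ∑ t, Γ u t s i * pd t h u

/-- `X` is a smooth solution on `U` of `d_∇(X ∘) = 0`. -/
def IsSolution (U : Set (Fin n → ℝ)) (c : StructureFunctions n) (Γ : Christoffel n)
    (X : VField n) : Prop :=
  ContDiffOn ℝ ∞ X U ∧ ∀ u ∈ U, ∀ i j k, dNabla Γ (mulMatrix c X) i j k u = 0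

/-- `Γ` is a smooth torsionless connection on `U` with `∇e = 0` and `d_∇(X ∘) = 0`. -/
structure IsAssociatedConnection (U : Set (Fin n → ℝ)) (c : StructureFunctions n) (e X : VField n)
    (Γ : Christoffel n) : Prop where
  smooth : ∀ i j k, ContDiffOn ℝ ∞ (fun u => Γ u i j k) U
  torsionless : ∀ u ∈ U, ∀ i j k, Γ u i j k = Γ u i k j
  flat_unit : ∀ u ∈ U, ∀ i j, covVec Γ e j i u = 0
  dNabla_eq_zero : ∀ u ∈ U, ∀ i j k, dNabla Γ (mulMatrix c X) i j k u = 0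

/-- The right-hand side, as a function of `(u, u_x)`, of the system `u_t = X ∘ u_x`. -/
def flow (c : StructureFunctions n) (X : VField n) (p : (Fin n → ℝ) × (Fin n → ℝ)) : Fin n → ℝ :=
  tmul c p.1 (X p.1) p.2

/-- The flows `u_t = K(u, u_x)` and `u_s = L(u, u_x)` commute over `U`: `(u_t)_s = (u_s)_t`
identically in the jet variables `u`, `v = u_x`, `a = u_xx`.  Here `(u_s)_x = dL(v, a)`, so
`(u_t)_s = dK(u_s, (u_s)_x) = dK(L, dL(v, a))`. -/
def FlowsCommute (U : Set (Fin n → ℝ)) (K L : (Fin n → ℝ) × (Fin n → ℝ) → (Fin n → ℝ)) : Prop :=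
  ∀ u ∈ U, ∀ v a : Fin n → ℝ,
    fderiv ℝ K (u, v) (L (u, v), fderiv ℝ L (u, v) (v, a))
      = fderiv ℝ L (u, v) (K (u, v), fderiv ℝ K (u, v) (v, a))

/-- `h` is a density of conservation laws on `W` for `u_t = K(u, u_x)`: locally on `W`,
`h_t = dh(K(u, u_x))` is a total `x`-derivative of a smooth function `F` of `u` and finitely many of
its `x`-derivatives.  A jet is the sequence `z = (u, u_x, u_xx, …)`, and the total derivative is
`D_x F = ∑_i (∂F / ∂z_i) z_{i+1}`. -/
def IsConservedDensity (W : Set (Fin n → ℝ)) (K : (Fin n → ℝ) × (Fin n → ℝ) → (Fin n → ℝ))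
    (h : (Fin n → ℝ) → ℝ) : Prop :=
  ∀ p ∈ W, ∃ N : Set (Fin n → ℝ), IsOpen N ∧ p ∈ N ∧ N ⊆ W ∧
    ∃ (q : ℕ) (F : (Fin (q + 1) → Fin n → ℝ) → ℝ),
      ContDiffOn ℝ ∞ F {y | y 0 ∈ N} ∧
      ∀ z : ℕ → Fin n → ℝ, z 0 ∈ N →
        fderiv ℝ h (z 0) (K (z 0, z 1))
          = fderiv ℝ F (fun i : Fin (q + 1) => z i) (fun i : Fin (q + 1) => z ((i : ℕ) + 1))

end RegularF

end

open RegularF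

/-! Put `V = X ∘` for the distinguished field `X`. In canonical coordinates the tangent algebra is a
product of truncated polynomial algebras. The conditions on the `1(α)` and `2(α)` components say
that `X` generates it, so the unit `e` is a cyclic vector of `V` (`isCyclicVector_unit`). Everything
else is pointwise linear algebra with this cyclic vector.

Connection: zero torsion, `∇e = 0` and `d_∇ V = 0` form a square linear system for the Christoffel
symbols. A solution of the homogeneous system is a symmetric bilinear map `B` with `B(a, Vb) = B(Va,
b)` and `B(a, e) = 0`. Hence `B(a, V^k e) = B(V^k a, e) = 0`, so `B = 0` (`connectionOp_injective`).
Inverting the system gives a smooth unique `Γ`.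

Flows: if the flows of `X` and `Y` commute, then `T = d_∇(Y ∘)` satisfies `T(Vv, v) = 0`. A skew `T`
with this property vanishes by cyclicity (`dMul_eq_zero_of_flowsCommute`), so every `X_(k)` solves
`d_∇(X_(k) ∘) = 0`.

Densities: `h` is conserved along `Y` exactly when the one-form `dh ∘ (Y ∘)` is closed
(`isConservedDensity_iff`). If `d_∇(Y ∘) = 0`, closedness reads `H(a, Y ∘ b) = H(b, Y ∘ a)` with `H
= ∇dh` (`isConservedDensity_flow_iff`). This is linear in `Y`, and the `X_(k)` span each tangent
space, so it holds for all `X_(k)` if and only if it holds for all tangent vectors, which is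
condition 2. -/

namespace RegularF

/-! ### Cyclic endomorphisms -/

section Cyclic

variable {E F : Type*} [AddCommGroup E] [Module ℝ E] [AddCommGroup F] [Module ℝ F]

/-- `e` is a cyclic vector of the endomorphism `V`. -/
def IsCyclicVector (V : E →ₗ[ℝ] E) (e : E) : Prop :=
  Submodule.span ℝ (Set.range fun k : ℕ => (V ^ k) e) = ⊤

lemma pow_shift_of_selfAdjoint (V : E →ₗ[ℝ] E) (B : E →ₗ[ℝ] E →ₗ[ℝ] F)
    (hV : ∀ a b, B a (V b) = B (V a) b) (k : ℕ) (a b : E) :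
    B a ((V ^ k) b) = B ((V ^ k) a) b := by
  induction k generalizing a b with
  | zero => simp
  | succ k ih =>
    rw [pow_succ', Module.End.mul_apply, hV, ih, ← Module.End.mul_apply, ← pow_succ, pow_succ']

/-- A bilinear map for which `V` is self-adjoint vanishes when it kills a cyclic vector of `V`. -/
lemma IsCyclicVector.bilin_eq_zero {V : E →ₗ[ℝ] E} {e : E} (he : IsCyclicVector V e)
    (B : E →ₗ[ℝ] E →ₗ[ℝ] F) (hV : ∀ a b, B a (V b) = B (V a) b) (hB : ∀ a, B a e = 0) :
    B = 0 := by
  ext a b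
  have : B a = 0 := LinearMap.ext_on_range he fun k => by
    rw [pow_shift_of_selfAdjoint V B hV, hB, LinearMap.zero_apply]
  simp [this]

/-- A skew bilinear map for which `V` is self-adjoint vanishes when `V` has a cyclic vector. -/
lemma IsCyclicVector.skew_eq_zero {V : E →ₗ[ℝ] E} {e : E} (he : IsCyclicVector V e)
    (B : E →ₗ[ℝ] E →ₗ[ℝ] F) (hskew : ∀ a b, B a b = -B b a) (hV : ∀ v, B (V v) v = 0) :
    B = 0 := by
  -- Polarizing `B(Vv, v) = 0` and using skewness turns it into self-adjointness.
  have hadj : ∀ a b, B a (V b) = B (V a) b := fun a b => by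
    have h := hV (a + b)
    simp only [map_add, LinearMap.add_apply, hV, zero_add, add_zero] at h
    rw [hskew a (V b), eq_neg_of_add_eq_zero_right h]
  refine he.bilin_eq_zero B hadj fun a => ?_
  have : B.flip e = 0 := LinearMap.ext_on_range he fun k => by
    -- Shifting all powers of `V` to the other argument gives `B(V^k e, e) = B(e, V^k e)`, which
    -- skewness makes its own negative.
    have h1 : B ((V ^ k) e) e = -B ((V ^ k) e) e := by
      conv_lhs => rw [← pow_shift_of_selfAdjoint V B hadj]
      exact hskew _ _
    have h2 : (2 : ℝ) • B ((V ^ k) e) e = 0 := by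
      rw [two_smul]; nth_rewrite 1 [h1]; exact neg_add_cancel _
    simpa using h2
  simpa using congrArg (fun f => f a) this

end Cyclic

variable {n : ℕ}

/-! ### Multiplication operators and Christoffel symbols as linear maps -/

/-- The operator of multiplication by a vector field. -/
noncomputable def mulOp (c : StructureFunctions n) (X : VField n) (u : Fin n → ℝ) :
    (Fin n → ℝ) →L[ℝ] (Fin n → ℝ) :=
  LinearMap.toContinuousLinearMap (Matrix.toLin' (mulMatrix c X u))

lemma mulOp_apply (c : StructureFunctions n) (X : VField n) (u a : Fin n → ℝ) :
    mulOp c X u a = tmul c u (X u) a := by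
  ext i
  simp only [mulOp, mulMatrix, LinearMap.coe_toContinuousLinearMap', Matrix.toLin'_apply,
    Matrix.mulVec, dotProduct, Matrix.of_apply, tmul, Finset.sum_mul]
  exact Finset.sum_comm

lemma mulOp_single (c : StructureFunctions n) (X : VField n) (u : Fin n → ℝ) (i k : Fin n) :
    mulOp c X u (Pi.single k 1) i = mulMatrix c X u i k := by
  simp [mulOp]

lemma mulOp_apply_eq_sum (c : StructureFunctions n) (X : VField n) (u a : Fin n → ℝ) (i : Fin n) :
    mulOp c X u a i = ∑ k, mulMatrix c X u i k * a k := by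
  simp [mulOp, Matrix.mulVec, dotProduct]

lemma contDiffOn_mulMatrix {W : Set (Fin n → ℝ)} {c : StructureFunctions n} {X : VField n}
    (hc : ∀ i j k, ContDiffOn ℝ ∞ (fun u => c u i j k) W) (hX : ContDiffOn ℝ ∞ X W)
    (i k : Fin n) : ContDiffOn ℝ ∞ (fun u => mulMatrix c X u i k) W := by
  simp only [mulMatrix, Matrix.of_apply]
  exact ContDiffOn.sum fun j _ => (hc i j k).mul (contDiffOn_pi.1 hX j)

lemma contDiffOn_mulOp {W : Set (Fin n → ℝ)} {c : StructureFunctions n} {X : VField n}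
    (hc : ∀ i j k, ContDiffOn ℝ ∞ (fun u => c u i j k) W) (hX : ContDiffOn ℝ ∞ X W) :
    ContDiffOn ℝ ∞ (mulOp c X) W := by
  refine contDiffOn_clm_apply.2 fun a => contDiffOn_pi.2 fun i => ?_
  simp only [mulOp_apply_eq_sum]
  exact ContDiffOn.sum fun k _ => (contDiffOn_mulMatrix hc hX i k).mul contDiffOn_const

/-- The bilinear map with components `G i j k`. -/
noncomputable def bilinOf (G : Fin n → Fin n → Fin n → ℝ) : (Fin n → ℝ) →ₗ[ℝ] (Fin n → ℝ) →ₗ[ℝ] (Fin n → ℝ) :=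
  LinearMap.mk₂ ℝ (fun a b i => ∑ j, ∑ k, G i j k * a j * b k)
    (fun a a' b => by ext i; simp [mul_add, add_mul, Finset.sum_add_distrib])
    (fun t a b => by
      ext i; simp only [Pi.smul_apply, smul_eq_mul, Finset.mul_sum]
      exact Finset.sum_congr rfl fun j _ => Finset.sum_congr rfl fun k _ => by ring)
    (fun a b b' => by ext i; simp [mul_add, Finset.sum_add_distrib])
    (fun t a b => by
      ext i; simp only [Pi.smul_apply, smul_eq_mul, Finset.mul_sum]
      exact Finset.sum_congr rfl fun j _ => Finset.sum_congr rfl fun k _ => by ring)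

lemma bilinOf_apply (G : Fin n → Fin n → Fin n → ℝ) (a b : Fin n → ℝ) (i : Fin n) :
    bilinOf G a b i = ∑ j, ∑ k, G i j k * a j * b k := rfl

lemma bilinOf_single_left (G : Fin n → Fin n → Fin n → ℝ) (b : Fin n → ℝ) (i j : Fin n) :
    bilinOf G (Pi.single j 1) b i = ∑ k, G i j k * b k := by
  rw [bilinOf_apply, Finset.sum_eq_single j]
  · simp
  · intro l _ hl; simp [hl]
  · simp

lemma bilinOf_single_single (G : Fin n → Fin n → Fin n → ℝ) (i j k : Fin n) :
    bilinOf G (Pi.single j 1) (Pi.single k 1) i = G i j k := by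
  rw [bilinOf_single_left, Finset.sum_eq_single k]
  · simp
  · intro l _ hl; simp [hl]
  · simp

lemma bilinOf_symm {G : Fin n → Fin n → Fin n → ℝ} (hG : ∀ i j k, G i j k = G i k j)
    (a b : Fin n → ℝ) : bilinOf G a b = bilinOf G b a := by
  ext i
  rw [bilinOf_apply, bilinOf_apply, Finset.sum_comm]
  exact Finset.sum_congr rfl fun j _ => Finset.sum_congr rfl fun k _ => by rw [hG]; ring

lemma tmul_eq_bilinOf (c : StructureFunctions n) (u a b : Fin n → ℝ) :
    tmul c u a b = bilinOf (c u) a b := rfl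

/-! ### The exterior covariant derivative as a bilinear map -/

/-- The exterior covariant derivative of an operator field `V` with derivative `dV`, for symmetric
Christoffel symbols `G`. -/
noncomputable def extCov (V : (Fin n → ℝ) →L[ℝ] (Fin n → ℝ))
    (dV : (Fin n → ℝ) →L[ℝ] (Fin n → ℝ) →L[ℝ] (Fin n → ℝ)) (G : Fin n → Fin n → Fin n → ℝ) :
    (Fin n → ℝ) →ₗ[ℝ] (Fin n → ℝ) →ₗ[ℝ] (Fin n → ℝ) :=
  LinearMap.mk₂ ℝ (fun a b => dV a b - dV b a + bilinOf G a (V b) - bilinOf G b (V a))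
    (fun a a' b => by simp only [map_add, LinearMap.add_apply, _root_.add_apply]; abel)
    (fun t a b => by
      simp only [map_smul, LinearMap.smul_apply, _root_.smul_apply, smul_sub, smul_add])
    (fun a b b' => by simp only [map_add, LinearMap.add_apply, _root_.add_apply]; abel)
    (fun t a b => by
      simp only [map_smul, LinearMap.smul_apply, _root_.smul_apply, smul_sub, smul_add])

lemma extCov_apply (V : (Fin n → ℝ) →L[ℝ] (Fin n → ℝ))
    (dV : (Fin n → ℝ) →L[ℝ] (Fin n → ℝ) →L[ℝ] (Fin n → ℝ)) (G : Fin n → Fin n → Fin n → ℝ)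
    (a b : Fin n → ℝ) :
    extCov V dV G a b = dV a b - dV b a + bilinOf G a (V b) - bilinOf G b (V a) := rfl

lemma fderiv_mulOp_single {c : StructureFunctions n} {X : VField n} {u : Fin n → ℝ}
    (hV : DifferentiableAt ℝ (mulOp c X) u) (i j k : Fin n) :
    fderiv ℝ (mulOp c X) u (Pi.single j 1) (Pi.single k 1) i
      = pd j (fun w => mulMatrix c X w i k) u := by
  have h1 : HasFDerivAt (fun w => mulOp c X w (Pi.single k 1))
      ((fderiv ℝ (mulOp c X) u).flip (Pi.single k 1)) u := by
    simpa using hV.hasFDerivAt.clm_apply (hasFDerivAt_const (Pi.single k (1 : ℝ)) u)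
  have h2 := hasFDerivAt_pi'.1 h1 i
  simp only [mulOp_single] at h2
  rw [pd, h2.fderiv]
  simp

/-- The tensor `d_∇ (X ∘)` at a point. -/
noncomputable abbrev dMul (c : StructureFunctions n) (X : VField n) (Γ : Christoffel n) (u : Fin n → ℝ) :
    (Fin n → ℝ) →ₗ[ℝ] (Fin n → ℝ) →ₗ[ℝ] (Fin n → ℝ) :=
  extCov (mulOp c X u) (fderiv ℝ (mulOp c X) u) (Γ u)

/-- The terms `Γ^s_{jk} V^i_s` cancel in the antisymmetrization because `Γ` is symmetric, which is
why `extCov` omits them. -/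
lemma dMul_single {c : StructureFunctions n} {X : VField n} {Γ : Christoffel n} {u : Fin n → ℝ}
    (hV : DifferentiableAt ℝ (mulOp c X) u) (hΓ : ∀ i j k, Γ u i j k = Γ u i k j) (i j k : Fin n) :
    dMul c X Γ u (Pi.single j 1) (Pi.single k 1) i = dNabla Γ (mulMatrix c X) i j k u := by
  simp only [dMul, extCov_apply, Pi.sub_apply, Pi.add_apply, fderiv_mulOp_single hV,
    bilinOf_single_left, mulOp_single, dNabla, covEnd]
  simp only [hΓ _ j k]
  ring

lemma dMul_eq_zero_iff {c : StructureFunctions n} {X : VField n} {Γ : Christoffel n}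
    {u : Fin n → ℝ} (hV : DifferentiableAt ℝ (mulOp c X) u)
    (hΓ : ∀ i j k, Γ u i j k = Γ u i k j) :
    dMul c X Γ u = 0 ↔ ∀ i j k, dNabla Γ (mulMatrix c X) i j k u = 0 := by
  constructor
  · intro h i j k
    rw [← dMul_single hV hΓ, h]; rfl
  · intro h
    refine LinearMap.pi_ext' fun j => LinearMap.ext_ring ?_
    refine LinearMap.pi_ext' fun k => LinearMap.ext_ring ?_
    ext i
    simpa using (dMul_single hV hΓ i j k).trans (h i j k)

/-! ### Regular elements are cyclic -/

section Canonical

variable {r : ℕ} {m : Fin r → ℕ}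

/-- The product of the algebra with the canonical structure constants. -/
noncomputable def canonicalMul (x y : BlockIndex m → ℝ) (I : BlockIndex m) : ℝ :=
  ∑ J, ∑ K, canonicalC I J K * x J * y K

/-- Orders of vanishing along a block add up under the canonical product, and the leading
coefficients are multiplied. -/
lemma canonicalMul_of_order {x y : BlockIndex m → ℝ} {α : Fin r} {p q : Fin (m α)}
    (hx : ∀ i < p, x ⟨α, i⟩ = 0) (hy : ∀ i < q, y ⟨α, i⟩ = 0) :
    (∀ i : Fin (m α), (i : ℕ) < p + q → canonicalMul x y ⟨α, i⟩ = 0) ∧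
      ∀ i : Fin (m α), (i : ℕ) = p + q → canonicalMul x y ⟨α, i⟩ = x ⟨α, p⟩ * y ⟨α, q⟩ := by
  constructor
  · intro i hi
    refine Finset.sum_eq_zero fun J _ => Finset.sum_eq_zero fun K _ => ?_
    unfold canonicalC
    split_ifs with h
    · obtain ⟨β, j⟩ := J
      obtain ⟨γ, k⟩ := K
      obtain ⟨h1, h2, h3⟩ := h
      dsimp only at h1 h2 h3
      subst h1 h2
      by_cases hj : j < p
      · simp [hx j hj]
      · have hk : k < q := by rw [Fin.lt_def] at hj ⊢; omega
        simp [hy k hk]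
    · simp
  · intro i hi
    unfold canonicalMul
    rw [Finset.sum_eq_single ⟨α, p⟩, Finset.sum_eq_single ⟨α, q⟩]
    · simp [canonicalC, hi]
    · rintro ⟨γ, k⟩ _ hk
      unfold canonicalC
      split_ifs with h
      · obtain ⟨h1, h2, h3⟩ := h
        dsimp only at h1 h2 h3
        subst h2
        exact absurd (by rw [show k = q from Fin.ext (by omega)]) hk
      · simp
    · simp
    · rintro ⟨β, j⟩ _ hj
      refine Finset.sum_eq_zero fun K _ => ?_
      unfold canonicalC
      split_ifs with h
      · obtain ⟨γ, k⟩ := K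
        obtain ⟨h1, h2, h3⟩ := h
        dsimp only at h1 h2 h3
        subst h1 h2
        by_cases hjp : j < p
        · simp [hx j hjp]
        · have hjp' : j ≠ p := fun h => hj (by rw [h])
          have hk : k < q := by
            rw [Fin.lt_def] at hjp ⊢
            have := fun h => hjp' (Fin.ext h)
            omega
          simp [hy k hk]
      · simp
    · simp

variable {U : Set (Fin n → ℝ)} {c : StructureFunctions n} {e E : VField n}
  {φ : (Fin n → ℝ) → BlockIndex m → ℝ}

lemma sum_blocks_eq (hφ : IsCanonicalCoordinates U c e E m φ) {u : Fin n → ℝ} (hu : u ∈ U) :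
    ∑ α, m α = n := by
  have := (LinearEquiv.ofBijective (fderiv ℝ φ u : (Fin n → ℝ) →ₗ[ℝ] BlockIndex m → ℝ)
    (hφ.bijective u hu)).finrank_eq
  simpa using this.symm

/-- Multiplication by `X` is triangular on each block, with `X^{1(α)}` on the diagonal. Hence `p(X
∘)` preserves the order of vanishing along the block and scales the leading coefficient by
`p(X^{1(α)})`. -/
lemma canonComp_aeval_of_order (hφ : IsCanonicalCoordinates U c e E m φ) {u : Fin n → ℝ}
    (hu : u ∈ U) (X : VField n) (p : Polynomial ℝ) {α : Fin r} (hα : 0 < m α) {k : Fin (m α)} :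
    ∀ a : Fin n → ℝ, (∀ i < k, canonComp φ u a ⟨α, i⟩ = 0) →
      (∀ i < k, canonComp φ u
        (Polynomial.aeval (mulOp c X u : (Fin n → ℝ) →ₗ[ℝ] (Fin n → ℝ)) p a) ⟨α, i⟩ = 0) ∧
      canonComp φ u
          (Polynomial.aeval (mulOp c X u : (Fin n → ℝ) →ₗ[ℝ] (Fin n → ℝ)) p a) ⟨α, k⟩
        = p.eval (canonComp φ u (X u) ⟨α, ⟨0, hα⟩⟩) * canonComp φ u a ⟨α, k⟩ := by
  induction p using Polynomial.induction_on with
  | C t =>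
    intro a ha
    simp only [Polynomial.aeval_C, Module.algebraMap_end_apply, Polynomial.eval_C]
    simp only [canonComp, map_smul, Pi.smul_apply, smul_eq_mul] at ha ⊢
    exact ⟨fun i hi => by rw [ha i hi, mul_zero], trivial⟩
  | add p q hp hq =>
    intro a ha
    have hp := hp a ha
    have hq := hq a ha
    simp only [canonComp, map_add, LinearMap.add_apply, Pi.add_apply, Polynomial.eval_add] at *
    exact ⟨fun i hi => by rw [hp.1 i hi, hq.1 i hi, add_zero], by rw [hp.2, hq.2, add_mul]⟩
  | monomial j t ih =>
    intro a ha
    have hx : ∀ i < (⟨0, hα⟩ : Fin (m α)), canonComp φ u (X u) ⟨α, i⟩ = 0 :=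
      fun i hi => absurd hi (by simp [Fin.lt_def])
    have key := canonicalMul_of_order (q := k) (y := canonComp φ u a) hx ha
    have hmul : ∀ I, canonComp φ u (mulOp c X u a) I
        = canonicalMul (canonComp φ u (X u)) (canonComp φ u a) I := fun I => by
      rw [mulOp_apply, hφ.prod_comp u hu]; rfl
    have h0 : ∀ i < k, canonComp φ u (mulOp c X u a) ⟨α, i⟩ = 0 := fun i hi => by
      rw [hmul]; exact key.1 i (by simpa using hi)
    have h1 := ih (mulOp c X u a) h0
    have heq : Polynomial.aeval (mulOp c X u : (Fin n → ℝ) →ₗ[ℝ] (Fin n → ℝ))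
          (Polynomial.C t * Polynomial.X ^ (j + 1)) a
        = Polynomial.aeval (mulOp c X u : (Fin n → ℝ) →ₗ[ℝ] (Fin n → ℝ))
          (Polynomial.C t * Polynomial.X ^ j) (mulOp c X u a) := by
      rw [pow_succ, ← mul_assoc, map_mul _ _ Polynomial.X, Polynomial.aeval_X]; rfl
    rw [heq]
    refine ⟨h1.1, ?_⟩
    rw [h1.2, hmul, key.2 k (by simp)]
    simp only [Polynomial.eval_mul, Polynomial.eval_C, Polynomial.eval_pow, Polynomial.eval_X]
    ring

/-- Subtracting `X^{1(α)} e` from `X` leaves an element of order at least one in block `α`, whose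
next coefficient is `X^{2(α)}`. Its `k`-th power therefore has order at least `k`, and exactly `k`
when `X^{2(α)} ≠ 0`. -/
lemma canonComp_sub_smul_pow_unit (hM : IsFManifold U c e)
    (hφ : IsCanonicalCoordinates U c e E m φ) {u : Fin n → ℝ} (hu : u ∈ U) (X : VField n)
    {α : Fin r} (hα : 0 < m α) (k : ℕ) (hk : k < m α) :
    (∀ i < (⟨k, hk⟩ : Fin (m α)), canonComp φ u
        (Polynomial.aeval (mulOp c X u : (Fin n → ℝ) →ₗ[ℝ] (Fin n → ℝ))
          ((Polynomial.X - Polynomial.C (canonComp φ u (X u) ⟨α, ⟨0, hα⟩⟩)) ^ k) (e u)) ⟨α, i⟩ = 0) ∧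
      ((∀ h : 1 < m α, canonComp φ u (X u) ⟨α, ⟨1, h⟩⟩ ≠ 0) → canonComp φ u
        (Polynomial.aeval (mulOp c X u : (Fin n → ℝ) →ₗ[ℝ] (Fin n → ℝ))
          ((Polynomial.X - Polynomial.C (canonComp φ u (X u) ⟨α, ⟨0, hα⟩⟩)) ^ k) (e u))
            ⟨α, ⟨k, hk⟩⟩ ≠ 0) := by
  induction k with
  | zero =>
    refine ⟨fun i hi => absurd hi (by simp [Fin.lt_def]), fun _ => ?_⟩
    simp [hφ.unit_comp u hu]
  | succ k ih =>
    obtain ⟨ih0, ih1⟩ := ih (by omega)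
    set l := canonComp φ u (X u) ⟨α, ⟨0, hα⟩⟩ with hl
    set a := Polynomial.aeval (mulOp c X u : (Fin n → ℝ) →ₗ[ℝ] (Fin n → ℝ))
          ((Polynomial.X - Polynomial.C l) ^ k) (e u) with ha
    have heq : Polynomial.aeval (mulOp c X u : (Fin n → ℝ) →ₗ[ℝ] (Fin n → ℝ))
          ((Polynomial.X - Polynomial.C l) ^ (k + 1)) (e u) = tmul c u (X u - l • e u) a := by
      rw [pow_succ', map_mul, Module.End.mul_apply, ← ha]
      simp only [map_sub, Polynomial.aeval_X, Polynomial.aeval_C, LinearMap.sub_apply,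
        Module.algebraMap_end_apply, tmul_eq_bilinOf, map_smul, LinearMap.smul_apply]
      rw [← tmul_eq_bilinOf, ← tmul_eq_bilinOf, hM.unit u hu, ← mulOp_apply]
      rfl
    have h1 : 1 < m α := by omega
    have hx : ∀ i < (⟨1, h1⟩ : Fin (m α)), canonComp φ u (X u - l • e u) ⟨α, i⟩ = 0 := by
      intro i hi
      have hi0 : i = ⟨0, hα⟩ := by ext; simpa [Fin.lt_def] using hi
      have := hφ.unit_comp u hu ⟨α, ⟨0, hα⟩⟩
      subst hi0
      simp only [canonComp, map_sub, map_smul, Pi.sub_apply, Pi.smul_apply] at this hl ⊢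
      rw [this, hl]; simp
    have hx1 : canonComp φ u (X u - l • e u) ⟨α, ⟨1, h1⟩⟩ = canonComp φ u (X u) ⟨α, ⟨1, h1⟩⟩ := by
      have := hφ.unit_comp u hu ⟨α, ⟨1, h1⟩⟩
      simp only [canonComp, map_sub, map_smul, Pi.sub_apply, Pi.smul_apply] at this ⊢
      rw [this]; simp
    have hmul : ∀ I, canonComp φ u (tmul c u (X u - l • e u) a) I
        = canonicalMul (canonComp φ u (X u - l • e u)) (canonComp φ u a) I := fun I =>
      hφ.prod_comp u hu _ _ I
    have key := canonicalMul_of_order hx ih0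
    rw [heq]
    refine ⟨fun i hi => ?_, fun h2 => ?_⟩
    · rw [hmul]
      exact key.1 i (by have := Fin.lt_def.1 hi; simp only at this ⊢; omega)
    · rw [hmul, key.2 _ (by simp [add_comm]), hx1]
      exact mul_ne_zero (h2 h1) (ih1 h2)

/-- A vector field with pairwise distinct `1(α)`-components and non-zero `2(α)`-components generates
the algebra of tangent vectors. -/
lemma isCyclicVector_unit (hM : IsFManifold U c e) (hm : ∀ α, 0 < m α)
    (hφ : IsCanonicalCoordinates U c e E m φ) {u : Fin n → ℝ} (hu : u ∈ U) (X : VField n)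
    (hX1 : ∀ α β, α ≠ β →
      canonComp φ u (X u) ⟨α, ⟨0, hm α⟩⟩ ≠ canonComp φ u (X u) ⟨β, ⟨0, hm β⟩⟩)
    (hX2 : ∀ α, ∀ hα : 1 < m α, canonComp φ u (X u) ⟨α, ⟨1, hα⟩⟩ ≠ 0) :
    IsCyclicVector (mulOp c X u : (Fin n → ℝ) →ₗ[ℝ] (Fin n → ℝ)) (e u) := by
  set V : (Fin n → ℝ) →ₗ[ℝ] (Fin n → ℝ) := (mulOp c X u).toLinearMap
  -- A polynomial annihilating `e` is divisible by `(x - X^{1(α)})^{m_α}` for every `α`; these roots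
  -- are distinct, so its degree is at least `∑ m_α = n`.
  have hpoly : ∀ p : Polynomial ℝ, p ≠ 0 → Polynomial.aeval V p (e u) = 0 → n ≤ p.natDegree := by
    intro p hp h0
    have hmult : ∀ α, m α ≤ p.rootMultiplicity (canonComp φ u (X u) ⟨α, ⟨0, hm α⟩⟩) := by
      intro α
      by_contra! hlt
      set l := canonComp φ u (X u) ⟨α, ⟨0, hm α⟩⟩ with hl
      obtain ⟨q, hq, hdvd⟩ := Polynomial.exists_eq_pow_rootMultiplicity_mul_and_not_dvd p hp l
      rw [Polynomial.dvd_iff_isRoot] at hdvd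
      -- If the multiplicity `k` of the root were below `m_α`, the component of `p(V) e` at position
      -- `k` of the block would be `q(l)` times a nonzero number.
      obtain ⟨k0, k1⟩ := canonComp_sub_smul_pow_unit hM hφ hu X (hm α) _ hlt
      have key := (canonComp_aeval_of_order hφ hu X q (hm α) _ k0).2
      rw [← Module.End.mul_apply, ← map_mul, mul_comm q, ← hl, ← hq, h0] at key
      have : canonComp φ u 0 ⟨α, ⟨_, hlt⟩⟩ = 0 := by simp [canonComp]
      rw [this, eq_comm, mul_eq_zero] at key
      exact key.elim hdvd (k1 (hX2 α))
    calc n = ∑ α, m α := (sum_blocks_eq hφ hu).symm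
      _ ≤ ∑ α, p.roots.count (canonComp φ u (X u) ⟨α, ⟨0, hm α⟩⟩) :=
        Finset.sum_le_sum fun α _ => by rw [Polynomial.count_roots]; exact hmult α
      _ = ∑ x ∈ Finset.univ.image fun α => canonComp φ u (X u) ⟨α, ⟨0, hm α⟩⟩, p.roots.count x :=
        (Finset.sum_image (f := fun x => p.roots.count x) fun α _ β _ h => by
          by_contra hne; exact hX1 α β hne h).symm
      _ ≤ ∑ x ∈ (Finset.univ.image fun α => canonComp φ u (X u) ⟨α, ⟨0, hm α⟩⟩) ∪ p.roots.toFinset,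
          p.roots.count x :=
        Finset.sum_le_sum_of_subset Finset.subset_union_left
      _ = p.roots.card :=
        Multiset.sum_count_eq_card fun x hx => Finset.mem_union_right _ (by simpa using hx)
      _ ≤ p.natDegree := p.card_roots'
  -- A linear relation among `e, Ve, …, V^{n-1} e` is an annihilating polynomial of degree below
  -- `n`, hence trivial.
  have hli : LinearIndependent ℝ fun k : Fin n => (V ^ (k : ℕ)) (e u) := by
    rw [Fintype.linearIndependent_iff]
    intro g hg
    set p : Polynomial ℝ := ∑ k : Fin n, Polynomial.monomial (k : ℕ) (g k) with hp
    have h0 : Polynomial.aeval V p (e u) = 0 := by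
      rw [hp, map_sum, LinearMap.sum_apply, ← hg]
      refine Finset.sum_congr rfl fun k _ => ?_
      rw [Polynomial.aeval_monomial, Module.End.mul_apply, Module.algebraMap_end_apply]
    have hp0 : p = 0 := by
      by_contra hne
      have h1 := hpoly p hne h0
      have h2 : p.degree < n := by
        refine (Polynomial.degree_sum_le _ _).trans_lt ?_
        refine (Finset.sup_lt_iff (WithBot.bot_lt_coe n)).2 fun k _ => ?_
        exact (Polynomial.degree_monomial_le _ _).trans_lt (Nat.cast_lt.2 k.2)
      rw [← Polynomial.natDegree_lt_iff_degree_lt hne] at h2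
      omega
    intro k
    have := congrArg (fun q => Polynomial.coeff q (k : ℕ)) hp0
    simpa [hp, Polynomial.finsetSum_coeff, Polynomial.coeff_monomial, Fin.val_inj] using this
  refine top_unique ?_
  rw [← hli.span_eq_top_of_card_eq_finrank' (by simp)]
  refine Submodule.span_mono ?_
  rintro _ ⟨k, rfl⟩
  exact ⟨k, rfl⟩

end Canonical

/-! ### The associated connection -/

/-- The operator taking the components of a connection to the algebraic parts of its torsion
(`j < k`), of `d_∇ V` (`k < j`) and of `∇ e` (`j = k`). -/
noncomputable def connectionOp (V : Matrix (Fin n) (Fin n) ℝ) (e : Fin n → ℝ) :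
    (Fin n → Fin n → Fin n → ℝ) →ₗ[ℝ] (Fin n → Fin n → Fin n → ℝ) where
  toFun G i j k :=
    if j < k then G i j k - G i k j
    else if k < j then (∑ s, G i j s * V s k - ∑ s, G s j k * V i s)
      - (∑ s, G i k s * V s j - ∑ s, G s k j * V i s)
    else ∑ s, G i j s * e s
  map_add' G G' := by
    ext i j k
    simp only [Pi.add_apply, add_mul, Finset.sum_add_distrib]
    split_ifs <;> ring
  map_smul' t G := by
    ext i j k
    simp only [Pi.smul_apply, smul_eq_mul, mul_assoc, ← Finset.mul_sum, RingHom.id_apply]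
    split_ifs <;> ring

/-- The inhomogeneous terms of the equations for the associated connection. -/
noncomputable def connectionRhs (V : (Fin n → ℝ) → Matrix (Fin n) (Fin n) ℝ) (e : VField n)
    (u : Fin n → ℝ) (i j k : Fin n) : ℝ :=
  if j < k then 0
  else if k < j then pd k (fun w => V w i j) u - pd j (fun w => V w i k) u
  else -pd j (fun w => e w i) u

/-- Torsion and `d_∇ V` are skew in `j, k`, so each is determined by half of the off-diagonal slots;
the diagonal slots are left for `∇e`. This packs all the conditions into an endomorphism of one
space, for which injectivity gives bijectivity. -/
lemma connectionOp_eq_rhs_iff (V : (Fin n → ℝ) → Matrix (Fin n) (Fin n) ℝ) (e : VField n)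
    (Γ : Christoffel n) (u : Fin n → ℝ) :
    connectionOp (V u) (e u) (Γ u) = connectionRhs V e u ↔
      (∀ i j k, Γ u i j k = Γ u i k j) ∧ (∀ i j, covVec Γ e j i u = 0) ∧
        ∀ i j k, dNabla Γ V i j k u = 0 := by
  constructor
  · intro h
    have h' : ∀ i j k, connectionOp (V u) (e u) (Γ u) i j k = connectionRhs V e u i j k :=
      fun i j k => by rw [h]
    simp only [connectionOp, LinearMap.coe_mk, AddHom.coe_mk, connectionRhs] at h'
    have ht : ∀ i j k, j < k → Γ u i j k = Γ u i k j := fun i j k hjk => by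
      have := h' i j k
      rw [if_pos hjk, if_pos hjk] at this
      linarith
    have hd : ∀ i j k, k < j → dNabla Γ V i j k u = 0 := fun i j k hjk => by
      have := h' i j k
      rw [if_neg hjk.not_gt, if_neg hjk.not_gt, if_pos hjk, if_pos hjk] at this
      simp only [dNabla, covEnd]
      linarith
    refine ⟨fun i j k => ?_, fun i j => ?_, fun i j k => ?_⟩
    · rcases lt_trichotomy j k with hjk | rfl | hjk
      exacts [ht i j k hjk, rfl, (ht i k j hjk).symm]
    · have := h' i j j
      simp only [lt_irrefl, if_false] at this
      simp only [covVec]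
      linarith
    · rcases lt_trichotomy j k with hjk | rfl | hjk
      · have := hd i k j hjk
        simp only [dNabla] at this ⊢
        linarith
      · simp [dNabla]
      · exact hd i j k hjk
  · rintro ⟨ht, he, hd⟩
    ext i j k
    simp only [connectionOp, LinearMap.coe_mk, AddHom.coe_mk, connectionRhs]
    split_ifs with h1 h2
    · rw [ht i j k, sub_self]
    · have := hd i j k
      simp only [dNabla, covEnd] at this
      linarith
    · have := he i j
      simp only [covVec] at this
      linarith

lemma connectionOp_injective {V : Matrix (Fin n) (Fin n) ℝ} {e : Fin n → ℝ}
    (hV : IsCyclicVector (Matrix.toLin' V) e) : Function.Injective (connectionOp V e) := by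
  rw [← LinearMap.ker_eq_bot, LinearMap.ker_eq_bot']
  intro G hG
  -- Applied to constant fields, whose derivatives vanish, the equivalence yields the homogeneous
  -- equations.
  obtain ⟨ht, he, hd⟩ := (connectionOp_eq_rhs_iff (fun _ => V) (fun _ => e) (fun _ => G) 0).1
    (by rw [hG]; ext i j k; simp [connectionRhs, pd])
  simp only [covVec, dNabla, covEnd, pd, fderiv_fun_const, Pi.zero_apply,
    zero_apply, zero_add] at he hd
  have hB : bilinOf G = 0 := by
    refine hV.bilin_eq_zero _ (fun a b => ?_) fun a => ?_
    · have h : (bilinOf G).compl₂ (Matrix.toLin' V) = ((bilinOf G).compl₂ (Matrix.toLin' V)).flip := by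
        refine LinearMap.pi_ext' fun j => LinearMap.ext_ring ?_
        refine LinearMap.pi_ext' fun k => LinearMap.ext_ring ?_
        ext i
        have h1 := hd i j k
        -- Symmetry of `G` cancels the terms `G^s_{jk} V^i_s`, leaving the symmetry of `G(a, Vb)` in
        -- `a, b`.
        simp only [ht _ j k] at h1
        simp [bilinOf_single_left]
        linarith
      rw [bilinOf_symm ht (Matrix.toLin' V a) b]
      exact LinearMap.congr_fun₂ h a b
    · have h : (bilinOf G).flip e = 0 := by
        refine LinearMap.pi_ext' fun j => LinearMap.ext_ring ?_
        ext i
        simp [bilinOf_single_left, he]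
      exact LinearMap.congr_fun h a
  ext i j k
  rw [← bilinOf_single_single G, hB]
  rfl

lemma contDiffOn_pd {U : Set (Fin n → ℝ)} (hU : IsOpen U) {f : (Fin n → ℝ) → ℝ}
    (hf : ContDiffOn ℝ ∞ f U) (i : Fin n) : ContDiffOn ℝ ∞ (pd i f) U :=
  (hf.fderiv_of_isOpen hU le_rfl).clm_apply contDiffOn_const

lemma exists_associatedConnection {U : Set (Fin n → ℝ)} (hU : IsOpen U) {c : StructureFunctions n}
    {e X : VField n} (hc : ∀ i j k, ContDiffOn ℝ ∞ (fun u => c u i j k) U)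
    (he : ContDiffOn ℝ ∞ e U) (hX : ContDiffOn ℝ ∞ X U)
    (hcyc : ∀ u ∈ U, IsCyclicVector (mulOp c X u : (Fin n → ℝ) →ₗ[ℝ] (Fin n → ℝ)) (e u)) :
    ∃ Γ : Christoffel n, IsAssociatedConnection U c e X Γ ∧
      ∀ Γ' : Christoffel n, IsAssociatedConnection U c e X Γ' → ∀ u ∈ U, Γ' u = Γ u := by
  set Λ : (Fin n → ℝ) → (Fin n → Fin n → Fin n → ℝ) →L[ℝ] (Fin n → Fin n → Fin n → ℝ) :=
    fun u => LinearMap.toContinuousLinearMap (connectionOp (mulMatrix c X u) (e u)) with hΛ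
  have hVs := contDiffOn_mulMatrix hc hX
  have hes := contDiffOn_pi.1 he
  have hΛs : ContDiffOn ℝ ∞ Λ U := by
    refine contDiffOn_clm_apply.2 fun G => contDiffOn_pi.2 fun i => contDiffOn_pi.2 fun j =>
      contDiffOn_pi.2 fun k => ?_
    simp only [hΛ, connectionOp, LinearMap.coe_toContinuousLinearMap', LinearMap.coe_mk,
      AddHom.coe_mk]
    split_ifs
    · exact contDiffOn_const
    · refine ContDiffOn.sub (ContDiffOn.sub ?_ ?_) (ContDiffOn.sub ?_ ?_) <;>
        exact ContDiffOn.sum fun s _ => contDiffOn_const.mul (hVs _ _)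
    · exact ContDiffOn.sum fun s _ => contDiffOn_const.mul (hes s)
  have hbs : ContDiffOn ℝ ∞ (connectionRhs (mulMatrix c X) e) U := by
    refine contDiffOn_pi.2 fun i => contDiffOn_pi.2 fun j => contDiffOn_pi.2 fun k => ?_
    simp only [connectionRhs]
    split_ifs
    · exact contDiffOn_const
    · exact (contDiffOn_pd hU (hVs _ _) k).sub (contDiffOn_pd hU (hVs _ _) j)
    · exact (contDiffOn_pd hU (hes i) j).neg
  have hinj : ∀ u ∈ U, Function.Injective (connectionOp (mulMatrix c X u) (e u)) := fun u hu =>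
    connectionOp_injective (hcyc u hu)
  have hequiv : ∀ u ∈ U, ∃ L : (Fin n → Fin n → Fin n → ℝ) ≃L[ℝ] (Fin n → Fin n → Fin n → ℝ),
      (L : (Fin n → Fin n → Fin n → ℝ) →L[ℝ] (Fin n → Fin n → Fin n → ℝ)) = Λ u := fun u hu =>
    ⟨(LinearEquiv.ofInjectiveEndo _ (hinj u hu)).toContinuousLinearEquiv, by ext; rfl⟩
  -- `inverse` is total, with a default value at non-invertible operators; on `U` it is the true
  -- inverse, and inversion is smooth there.
  set Γ : Christoffel n := fun u => (Λ u).inverse (connectionRhs (mulMatrix c X) e u) with hΓ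
  have hΓs : ContDiffOn ℝ ∞ Γ U := by
    refine ContDiffOn.clm_apply (fun u hu => ?_) hbs
    obtain ⟨L, hL⟩ := hequiv u hu
    have h1 : ContDiffAt ℝ ∞ ContinuousLinearMap.inverse (Λ u) := hL ▸ contDiffAt_map_inverse L
    exact h1.comp_contDiffWithinAt u (hΛs u hu)
  have hsol : ∀ u ∈ U, connectionOp (mulMatrix c X u) (e u) (Γ u)
      = connectionRhs (mulMatrix c X) e u := fun u hu => by
    obtain ⟨L, hL⟩ := hequiv u hu
    change Λ u ((Λ u).inverse _) = _
    rw [← hL, ContinuousLinearMap.inverse_equiv]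
    simp
  have hsol' := fun u hu => (connectionOp_eq_rhs_iff (mulMatrix c X) e Γ u).1 (hsol u hu)
  refine ⟨Γ, ⟨fun i j k => ?_, fun u hu => (hsol' u hu).1, fun u hu => (hsol' u hu).2.1,
    fun u hu => (hsol' u hu).2.2⟩, fun Γ' h u hu => ?_⟩
  · exact contDiffOn_pi.1 (contDiffOn_pi.1 (contDiffOn_pi.1 hΓs i) j) k
  · refine hinj u hu ?_
    rw [hsol u hu]
    exact (connectionOp_eq_rhs_iff (mulMatrix c X) e Γ' u).2
      ⟨h.torsionless u hu, h.flat_unit u hu, h.dNabla_eq_zero u hu⟩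

/-! ### Commuting flows -/

lemma flow_eq (c : StructureFunctions n) (X : VField n) (p : (Fin n → ℝ) × (Fin n → ℝ)) :
    flow c X p = mulOp c X p.1 p.2 := (mulOp_apply c X p.1 p.2).symm

lemma fderiv_flow {c : StructureFunctions n} {X : VField n} {u : Fin n → ℝ}
    (hV : DifferentiableAt ℝ (mulOp c X) u) (v a b : Fin n → ℝ) :
    fderiv ℝ (flow c X) (u, v) (a, b) = fderiv ℝ (mulOp c X) u a v + mulOp c X u b := by
  have h1 : HasFDerivAt (fun p : (Fin n → ℝ) × (Fin n → ℝ) => mulOp c X p.1)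
      ((fderiv ℝ (mulOp c X) u).comp (ContinuousLinearMap.fst ℝ _ _)) (u, v) :=
    HasFDerivAt.comp (u, v) (g := mulOp c X) hV.hasFDerivAt hasFDerivAt_fst
  have h2 := h1.clm_apply (hasFDerivAt_snd (p := (u, v)) (𝕜 := ℝ))
  have h3 : flow c X = fun p => mulOp c X p.1 p.2 := funext (flow_eq c X)
  rw [h3, h2.fderiv]
  simp [add_comm]

lemma mulOp_comm {U : Set (Fin n → ℝ)} {c : StructureFunctions n} {e : VField n}
    (hM : IsFManifold U c e) {u : Fin n → ℝ} (hu : u ∈ U) (X Y : VField n) (a : Fin n → ℝ) :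
    mulOp c X u (mulOp c Y u a) = mulOp c Y u (mulOp c X u a) := by
  simp only [mulOp_apply]
  rw [← hM.assoc u hu, hM.comm u hu (X u), hM.assoc u hu]

/-- If the flows of `X` and `Y` commute and `d_∇ (X ∘) = 0`, where `X` generates the algebra of
tangent vectors, then `d_∇ (Y ∘) = 0`. -/
lemma dMul_eq_zero_of_flowsCommute {U : Set (Fin n → ℝ)} (hU : IsOpen U)
    {c : StructureFunctions n} {e : VField n} (hM : IsFManifold U c e) {X Y : VField n}
    (hX : ContDiffOn ℝ ∞ X U) (hY : ContDiffOn ℝ ∞ Y U)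
    (hcomm : FlowsCommute U (flow c X) (flow c Y)) {Γ : Christoffel n} {u : Fin n → ℝ} (hu : u ∈ U)
    (hcyc : IsCyclicVector (mulOp c X u : (Fin n → ℝ) →ₗ[ℝ] (Fin n → ℝ)) (e u))
    (hΓ : ∀ i j k, Γ u i j k = Γ u i k j) (hT : dMul c X Γ u = 0) : dMul c Y Γ u = 0 := by
  have hVd : DifferentiableAt ℝ (mulOp c X) u :=
    ((contDiffOn_mulOp hM.smooth_prod hX).contDiffAt (hU.mem_nhds hu)).differentiableAt (by simp)
  have hWd : DifferentiableAt ℝ (mulOp c Y) u :=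
    ((contDiffOn_mulOp hM.smooth_prod hY).contDiffAt (hU.mem_nhds hu)).differentiableAt (by simp)
  refine hcyc.skew_eq_zero _ (fun a b => ?_) fun v => ?_
  · simp only [extCov_apply]; abel
  -- Taking `u_xx = 0` suffices: the `u_xx` terms agree anyway, since multiplication operators
  -- commute.
  have hc := hcomm u hu v 0
  simp only [fderiv_flow hVd, fderiv_flow hWd, flow_eq, map_zero, add_zero] at hc
  have hT' : dMul c X Γ u (mulOp c Y u v) v = 0 := by rw [hT]; rfl
  -- This is the derivative along `v` of the identity `(X ∘)(Y ∘) v = (Y ∘)(X ∘) v`.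
  have hVW : fderiv ℝ (mulOp c X) u v (mulOp c Y u v) + mulOp c X u (fderiv ℝ (mulOp c Y) u v v)
      = fderiv ℝ (mulOp c Y) u v (mulOp c X u v)
        + mulOp c Y u (fderiv ℝ (mulOp c X) u v v) := by
    have h1 : HasFDerivAt (fun w => mulOp c X w (mulOp c Y w v)) _ u :=
      hVd.hasFDerivAt.clm_apply (hWd.hasFDerivAt.clm_apply (hasFDerivAt_const v u))
    have h2 : HasFDerivAt (fun w => mulOp c Y w (mulOp c X w v)) _ u :=
      hWd.hasFDerivAt.clm_apply (hVd.hasFDerivAt.clm_apply (hasFDerivAt_const v u))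
    have h3 := h1.unique (h2.congr_of_eventuallyEq
      (Filter.eventuallyEq_of_mem (hU.mem_nhds hu) fun w hw => mulOp_comm hM hw X Y v))
    have h4 := congrArg (fun f => f v) h3
    simp at h4
    rw [add_comm, h4, add_comm]
  have hVW0 := mulOp_comm hM hu X Y v
  simp only [dMul, extCov_apply, ContinuousLinearMap.coe_coe] at hT' ⊢
  rw [hVW0] at hT'
  -- Subtracting the derivative identity from the commutation identity, the Christoffel terms match
  -- by symmetry and `d_∇(Y ∘)(Xv, v) = d_∇(X ∘)(Yv, v) = 0`, where `Xv` and `Yv` denote products.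
  linear_combination (exp := 1) hT' - hc + hVW + bilinOf_symm hΓ (mulOp c X u v) (mulOp c Y u v)

/-! ### Densities of conservation laws -/

open Filter Topology in
/-- A one-form whose contraction with `u_x` is a total `x`-derivative is locally exact. -/
lemma fderiv_zero_jet_eq {N : Set (Fin n → ℝ)} (hN : IsOpen N) {q : ℕ}
    {F : (Fin (q + 1) → Fin n → ℝ) → ℝ} (hF : ContDiffOn ℝ ∞ F {y | y 0 ∈ N})
    {θ : (Fin n → ℝ) → (Fin n → ℝ) →L[ℝ] ℝ}
    (h : ∀ z : ℕ → Fin n → ℝ, z 0 ∈ N → θ (z 0) (z 1)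
      = fderiv ℝ F (fun i : Fin (q + 1) => z i) (fun i : Fin (q + 1) => z ((i : ℕ) + 1)))
    {u : Fin n → ℝ} (hu : u ∈ N) :
    HasFDerivAt (fun w => F (Pi.single 0 w)) (θ u) u := by
  have hD : IsOpen {y : Fin (q + 1) → Fin n → ℝ | y 0 ∈ N} := hN.preimage (continuous_apply 0)
  have hmem : (Pi.single 0 u : Fin (q + 1) → Fin n → ℝ) ∈ {y : Fin (q + 1) → Fin n → ℝ | y 0 ∈ N} := by
    simpa using hu
  have hd : DifferentiableAt ℝ F (Pi.single 0 u) :=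
    (hF.contDiffAt (hD.mem_nhds hmem)).differentiableAt (by simp)
  have hcomp : HasFDerivAt (fun w => F (Pi.single 0 w))
      ((fderiv ℝ F (Pi.single 0 u)).comp
        (ContinuousLinearMap.single ℝ (fun _ : Fin (q + 1) => Fin n → ℝ) 0)) u :=
    HasFDerivAt.comp u (g := F) hd.hasFDerivAt
      (ContinuousLinearMap.single ℝ (fun _ : Fin (q + 1) => Fin n → ℝ) 0).hasFDerivAt
  convert hcomp using 1
  ext1 v
  -- Test jets `(u, t v, 0, …)`. Both sides of the identity carry a factor `t`; dividing by it and
  -- letting `t → 0` evaluates `dF` at the jet `(u, 0, …, 0)`.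
  set z : ℝ → ℕ → Fin n → ℝ := fun t i => if i = 0 then u else if i = 1 then t • v else 0 with hz
  set g : ℝ → ℝ := fun t => fderiv ℝ F (fun i : Fin (q + 1) => z t i) (Pi.single 0 v) with hg
  have hg_ne : ∀ t : ℝ, t ≠ 0 → g t = θ u v := by
    intro t ht
    have h1 := h (z t) (by simpa [hz] using hu)
    have h2 : (fun i : Fin (q + 1) => z t ((i : ℕ) + 1)) = t • Pi.single 0 v := by
      ext1 i
      by_cases hi : i = 0
      · subst hi; simp [hz]
      · have : (i : ℕ) ≠ 0 := fun h => hi (Fin.ext h)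
        simp [hz, hi, this]
    rw [h2, map_smul] at h1
    simp only [hz, if_true, one_ne_zero, if_false, map_smul, smul_eq_mul] at h1
    exact (mul_left_cancel₀ ht h1).symm
  have hz0 : (fun i : Fin (q + 1) => z 0 i) = Pi.single 0 u := by
    ext1 i
    by_cases hi : i = 0
    · subst hi; simp [hz]
    · have : (i : ℕ) ≠ 0 := fun h => hi (Fin.ext h)
      simp [hz, hi, this]
  have hcont : ContinuousAt g 0 := by
    have h1 : ContinuousAt (fderiv ℝ F) (fun i : Fin (q + 1) => z 0 i) := by
      rw [hz0]
      exact (hF.continuousOn_fderiv_of_isOpen hD (by simp)).continuousAt (hD.mem_nhds hmem)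
    have h2 : Continuous fun (t : ℝ) (i : Fin (q + 1)) => z t i := by
      refine continuous_pi fun i => ?_
      simp only [hz]
      split_ifs <;> fun_prop
    exact (h1.comp (f := fun (t : ℝ) (i : Fin (q + 1)) => z t i) h2.continuousAt).clm_apply
      continuousAt_const
  have hlim : Tendsto g (𝓝[≠] 0) (𝓝 (θ u v)) :=
    tendsto_const_nhds.congr' (eventually_nhdsWithin_of_forall fun t ht => (hg_ne t ht).symm)
  have := tendsto_nhds_unique hlim (hcont.tendsto.mono_left nhdsWithin_le_nhds)
  simp only [hg, hz0] at this
  exact this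

/-- `h` is a density of conservation laws for `u_t = K(u, u_x)`, with `K` linear in `u_x`, if and
only if the one-form `dh ∘ K` is closed. -/
lemma isConservedDensity_iff {W : Set (Fin n → ℝ)} (hW : IsOpen W)
    {K : (Fin n → ℝ) × (Fin n → ℝ) → (Fin n → ℝ)} {h : (Fin n → ℝ) → ℝ}
    {θ : (Fin n → ℝ) → (Fin n → ℝ) →L[ℝ] ℝ} (hθ : ContDiffOn ℝ ∞ θ W)
    (hK : ∀ u ∈ W, ∀ v, fderiv ℝ h u (K (u, v)) = θ u v) :
    IsConservedDensity W K h ↔ ∀ u ∈ W, ∀ a b, fderiv ℝ θ u a b = fderiv ℝ θ u b a := by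
  constructor
  · intro hcons u hu a b
    obtain ⟨N, hN, huN, hNW, q, F, hF, hz⟩ := hcons u hu
    have hder : ∀ w ∈ N, HasFDerivAt (fun w => F (Pi.single 0 w)) (θ w) w := fun w hw =>
      fderiv_zero_jet_eq hN hF (fun z hz0 => by rw [← hK _ (hNW hz0), hz z hz0]) hw
    have hev : ∀ᶠ w in nhds u, HasFDerivAt (fun w => F (Pi.single 0 w)) (θ w) w :=
      Filter.eventually_of_mem (hN.mem_nhds huN) hder
    exact second_derivative_symmetric_of_eventually hev
      ((hθ.contDiffAt (hW.mem_nhds hu)).differentiableAt (by simp)).hasFDerivAt a b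
  · intro hclosed p hp
    -- By the Poincaré lemma on a ball, the closed form has a potential `f`; this serves as a
    -- function of the jet of order zero.
    obtain ⟨ε, hε, hball⟩ := Metric.isOpen_iff.1 hW p hp
    obtain ⟨f, hf⟩ := (convex_ball p ε).exists_forall_hasFDerivAt_of_fderiv_symmetric
      Metric.isOpen_ball ((hθ.mono hball).differentiableOn (by simp))
      fun a ha x y => hclosed a (hball ha) x y
    refine ⟨Metric.ball p ε, Metric.isOpen_ball, Metric.mem_ball_self hε, hball, 0,
      fun y => f (y 0), ?_, fun z hz => ?_⟩
    · have hfs : ContDiffOn ℝ ∞ f (Metric.ball p ε) := by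
        rw [contDiffOn_infty_iff_fderiv_of_isOpen Metric.isOpen_ball]
        exact ⟨fun a ha => (hf a ha).differentiableAt.differentiableWithinAt,
          (hθ.mono hball).congr fun a ha => (hf a ha).fderiv⟩
      exact hfs.comp (contDiff_apply ℝ (Fin n → ℝ) (0 : Fin (0 + 1))).contDiffOn fun y hy => hy
    · have h1 : HasFDerivAt (fun y : Fin (0 + 1) → Fin n → ℝ => f (y 0))
          ((θ (z 0)).comp (ContinuousLinearMap.proj 0)) (fun i : Fin (0 + 1) => z i) :=
        HasFDerivAt.comp (fun i : Fin (0 + 1) => z i) (g := f) (hf _ hz)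
          (ContinuousLinearMap.proj (R := ℝ) (φ := fun _ : Fin (0 + 1) => Fin n → ℝ) 0).hasFDerivAt
      rw [h1.fderiv, hK _ (hball hz)]
      simp

/-! ### Conservation laws in terms of the covariant Hessian -/

/-- The covariant Hessian of a function with differential `dh` and second differential `H`. -/
noncomputable def covHess (H : (Fin n → ℝ) →L[ℝ] (Fin n → ℝ) →L[ℝ] ℝ) (dh : (Fin n → ℝ) →L[ℝ] ℝ)
    (G : Fin n → Fin n → Fin n → ℝ) : (Fin n → ℝ) →ₗ[ℝ] (Fin n → ℝ) →ₗ[ℝ] ℝ :=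
  LinearMap.mk₂ ℝ (fun a b => H a b - dh (bilinOf G a b))
    (fun a a' b => by simp only [map_add, LinearMap.add_apply, _root_.add_apply]; ring)
    (fun t a b => by simp only [map_smul, LinearMap.smul_apply, _root_.smul_apply, smul_sub])
    (fun a b b' => by simp only [map_add]; ring)
    (fun t a b => by simp only [map_smul, smul_sub])

lemma covHess_apply (H : (Fin n → ℝ) →L[ℝ] (Fin n → ℝ) →L[ℝ] ℝ) (dh : (Fin n → ℝ) →L[ℝ] ℝ)
    (G : Fin n → Fin n → Fin n → ℝ) (a b : Fin n → ℝ) :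
    covHess H dh G a b = H a b - dh (bilinOf G a b) := rfl

lemma bilinOf_single_single_eq_sum (G : Fin n → Fin n → Fin n → ℝ) (j k : Fin n) :
    bilinOf G (Pi.single j 1) (Pi.single k 1)
      = ∑ t, G t j k • (Pi.single t (1 : ℝ) : Fin n → ℝ) := by
  ext t
  rw [bilinOf_single_single]
  simp [Finset.sum_apply, Pi.single_apply]

lemma covHess_single {h : (Fin n → ℝ) → ℝ} {Γ : Christoffel n} {u : Fin n → ℝ}
    (hh : DifferentiableAt ℝ (fderiv ℝ h) u) (s i : Fin n) :
    covHess (fderiv ℝ (fderiv ℝ h) u) (fderiv ℝ h u) (Γ u) (Pi.single s 1) (Pi.single i 1)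
      = covDiff Γ h s i u := by
  have h1 : HasFDerivAt (fun w => fderiv ℝ h w (Pi.single i 1))
      ((fderiv ℝ (fderiv ℝ h) u).flip (Pi.single i 1)) u := by
    simpa using hh.hasFDerivAt.clm_apply (hasFDerivAt_const (Pi.single i (1 : ℝ)) u)
  simp only [covHess_apply, covDiff, pd, bilinOf_single_single_eq_sum, map_sum, map_smul, smul_eq_mul]
  rw [h1.fderiv]
  simp

/-- With `V = Y ∘` and `H = ∇dh`, the exterior derivative of `dh ∘ V` on `(a, b)` is `H(a, Vb) -
H(b, Va) + dh(d_∇ V(a, b))`, and the last term vanishes by `hT`. -/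
lemma isConservedDensity_flow_iff {W : Set (Fin n → ℝ)} (hW : IsOpen W) {c : StructureFunctions n}
    (hc : ∀ i j k, ContDiffOn ℝ ∞ (fun u => c u i j k) W) {Y : VField n} (hY : ContDiffOn ℝ ∞ Y W)
    {h : (Fin n → ℝ) → ℝ} (hh : ContDiffOn ℝ ∞ h W) {Γ : Christoffel n}
    (hT : ∀ u ∈ W, dMul c Y Γ u = 0) :
    IsConservedDensity W (flow c Y) h ↔ ∀ u ∈ W, ∀ a b,
      covHess (fderiv ℝ (fderiv ℝ h) u) (fderiv ℝ h u) (Γ u) a (tmul c u (Y u) b)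
        = covHess (fderiv ℝ (fderiv ℝ h) u) (fderiv ℝ h u) (Γ u) b (tmul c u (Y u) a) := by
  have hdh : ContDiffOn ℝ ∞ (fderiv ℝ h) W := hh.fderiv_of_isOpen hW (by simp)
  have hV := contDiffOn_mulOp hc hY
  rw [isConservedDensity_iff hW (θ := fun u => (fderiv ℝ h u).comp (mulOp c Y u))
    (hdh.clm_comp hV) fun u _ v => by simp only [flow, ← mulOp_apply]; rfl]
  refine forall₂_congr fun u hu => forall₂_congr fun a b => ?_
  have hdhd := ((hdh.contDiffAt (hW.mem_nhds hu)).differentiableAt (by simp)).hasFDerivAt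
  have hVd := ((hV.contDiffAt (hW.mem_nhds hu)).differentiableAt (by simp)).hasFDerivAt
  have hTab := congrArg (fun f => fderiv ℝ h u (f a b)) (hT u hu)
  rw [(hdhd.clm_comp hVd).fderiv]
  simp only [dMul, extCov_apply, map_sub, map_add, LinearMap.zero_apply, map_zero] at hTab
  simp only [covHess_apply, ← mulOp_apply]
  simp
  constructor <;> intro h1 <;> linarith

lemma covHess_symm {h : (Fin n → ℝ) → ℝ} {Γ : Christoffel n} {u : Fin n → ℝ}
    (hh : ContDiffAt ℝ ∞ h u) (hΓ : ∀ i j k, Γ u i j k = Γ u i k j) (a b : Fin n → ℝ) :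
    covHess (fderiv ℝ (fderiv ℝ h) u) (fderiv ℝ h u) (Γ u) a b
      = covHess (fderiv ℝ (fderiv ℝ h) u) (fderiv ℝ h u) (Γ u) b a := by
  rw [covHess_apply, covHess_apply, bilinOf_symm hΓ a b,
    hh.isSymmSndFDerivAt (by
      rw [minSmoothness_of_isRCLikeNormedField]; exact WithTop.coe_le_coe.2 le_top) a b]

/-- The condition `c^s_{kj} D_{si} = c^s_{ij} D_{sk}` in invariant form. -/
lemma sum_structure_mul_eq_iff {C : Fin n → Fin n → Fin n → ℝ}
    (hC : ∀ a b, bilinOf C a b = bilinOf C b a) {H : (Fin n → ℝ) →ₗ[ℝ] (Fin n → ℝ) →ₗ[ℝ] ℝ}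
    (hH : ∀ a b, H a b = H b a) {D : Fin n → Fin n → ℝ}
    (hD : ∀ s i, H (Pi.single s 1) (Pi.single i 1) = D s i) :
    (∀ i j k, ∑ s, C s k j * D s i = ∑ s, C s i j * D s k) ↔
      ∀ y a b, H a (bilinOf C y b) = H b (bilinOf C y a) := by
  have hsum : ∀ i j k, H (Pi.single i 1) (bilinOf C (Pi.single j 1) (Pi.single k 1))
      = ∑ s, C s k j * D s i := fun i j k => by
    rw [hC, bilinOf_single_single_eq_sum, map_sum]
    exact Finset.sum_congr rfl fun s _ => by rw [map_smul, hH, hD, smul_eq_mul]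
  constructor
  · intro h
    have h1 : ∀ j a b, H a (bilinOf C (Pi.single j 1) b) = H b (bilinOf C (Pi.single j 1) a) := by
      intro j
      have : H.compl₂ (bilinOf C (Pi.single j 1)) = (H.compl₂ (bilinOf C (Pi.single j 1))).flip := by
        refine LinearMap.pi_ext' fun i => LinearMap.ext_ring ?_
        refine LinearMap.pi_ext' fun k => LinearMap.ext_ring ?_
        exact (hsum i j k).trans ((h i j k).trans (hsum k j i).symm)
      exact fun a b => LinearMap.congr_fun₂ this a b
    intro y a b
    have : (H a).comp ((bilinOf C).flip b) = (H b).comp ((bilinOf C).flip a) :=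
      LinearMap.pi_ext' fun j => LinearMap.ext_ring (h1 j a b)
    exact LinearMap.congr_fun this y
  · intro h i j k
    rw [← hsum, ← hsum, h]

end RegularF

/-! ### The main theorem -/

theorem mainTheorem9 {n : ℕ} (U : Set (Fin n → ℝ)) (hU : IsOpen U)
    (c : StructureFunctions n) (e E : VField n) (hM : IsRegularFManifold U c e E)
    {r : ℕ} (m : Fin r → ℕ) (hm : ∀ α, 0 < m α) (φ : (Fin n → ℝ) → BlockIndex m → ℝ)
    (hφ : IsCanonicalCoordinates U c e E m φ)
    (X : Fin n → VField n) (hX : ∀ k, ContDiffOn ℝ ∞ (X k) U)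
    (hXind : ∀ u ∈ U, LinearIndependent ℝ (fun k => X k u))
    (hXcomm : ∀ k l, FlowsCommute U (flow c (X k)) (flow c (X l)))
    (k₀ : Fin n)
    (hX1 : ∀ u ∈ U, ∀ α β, α ≠ β →
      canonComp φ u (X k₀ u) ⟨α, ⟨0, hm α⟩⟩ ≠ canonComp φ u (X k₀ u) ⟨β, ⟨0, hm β⟩⟩)
    (hX2 : ∀ u ∈ U, ∀ α, ∀ hα : 1 < m α, canonComp φ u (X k₀ u) ⟨α, ⟨1, hα⟩⟩ ≠ 0) :
    ∃ Γ : Christoffel n,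
      IsAssociatedConnection U c e (X k₀) Γ ∧
      (∀ Γ' : Christoffel n, IsAssociatedConnection U c e (X k₀) Γ' → ∀ u ∈ U, Γ' u = Γ u) ∧
      ∀ h : (Fin n → ℝ) → ℝ, ContDiffOn ℝ ∞ h U →
        (((∀ k, IsConservedDensity U (flow c (X k)) h) ∧
            ∀ (W : Set (Fin n → ℝ)) (Y : VField n), IsOpen W → W ⊆ U → IsSolution W c Γ Y →
              IsConservedDensity W (flow c Y) h) ↔
          ∀ u ∈ U, ∀ i j k,
            ∑ s, c u s k j * covDiff Γ h s i u = ∑ s, c u s i j * covDiff Γ h s k u) := by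
  have hF := hM.fManifold
  have hcyc := fun u hu => isCyclicVector_unit hF hm hφ hu (X k₀) (hX1 u hu) (hX2 u hu)
  obtain ⟨Γ, hΓ, huniq⟩ :=
    exists_associatedConnection hU hF.smooth_prod hF.smooth_unit (hX k₀) hcyc
  refine ⟨Γ, hΓ, huniq, fun h hh => ?_⟩
  have hdiff : ∀ {W : Set (Fin n → ℝ)} {Y : VField n}, IsOpen W → W ⊆ U → ContDiffOn ℝ ∞ Y W →
      ∀ u ∈ W, DifferentiableAt ℝ (mulOp c Y) u := fun hW hWU hY u hu =>
    ((contDiffOn_mulOp (fun i j k => (hF.smooth_prod i j k).mono hWU) hY).contDiffAt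
      (hW.mem_nhds hu)).differentiableAt (by simp)
  have hT₀ : ∀ u ∈ U, dMul c (X k₀) Γ u = 0 := fun u hu =>
    (dMul_eq_zero_iff (hdiff hU subset_rfl (hX k₀) u hu) (hΓ.torsionless u hu)).2
      (hΓ.dNabla_eq_zero u hu)
  have hT : ∀ k, ∀ u ∈ U, dMul c (X k) Γ u = 0 := fun k u hu =>
    dMul_eq_zero_of_flowsCommute hU hF (hX k₀) (hX k) (hXcomm k₀ k) hu (hcyc u hu)
      (hΓ.torsionless u hu) (hT₀ u hu)
  have hhd : ∀ u ∈ U, DifferentiableAt ℝ (fderiv ℝ h) u := fun u hu =>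
    ((hh.fderiv_of_isOpen hU (m := ∞) (by simp)).contDiffAt (hU.mem_nhds hu)).differentiableAt
      (by simp)
  have hiff := fun u hu => sum_structure_mul_eq_iff (hF.comm u hu)
    (covHess_symm (hh.contDiffAt (hU.mem_nhds hu)) (hΓ.torsionless u hu)) (covHess_single (hhd u hu))
  constructor
  -- The `n` given flows alone imply condition 2, because they span the tangent space at each point.
  · rintro ⟨hcons, -⟩ u hu
    refine (hiff u hu).2 fun y a b => ?_
    set H := covHess (fderiv ℝ (fderiv ℝ h) u) (fderiv ℝ h u) (Γ u)
    have hspan : Submodule.span ℝ (Set.range fun k => X k u) = ⊤ :=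
      (hXind u hu).span_eq_top_of_card_eq_finrank' (by simp)
    have : (H a).comp ((bilinOf (c u)).flip b) = (H b).comp ((bilinOf (c u)).flip a) :=
      LinearMap.ext_on_range hspan fun k =>
        (isConservedDensity_flow_iff hU hF.smooth_prod (hX k) hh (hT k)).1 (hcons k) u hu a b
    exact LinearMap.congr_fun this y
  · intro h2
    -- Conversely, setting `y = Y(u)` in the invariant form of condition 2 is exactly the closedness
    -- condition for the flow of `Y`.
    have hcons : ∀ (W : Set (Fin n → ℝ)) (Y : VField n), IsOpen W → W ⊆ U → ContDiffOn ℝ ∞ Y W →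
        (∀ u ∈ W, dMul c Y Γ u = 0) → IsConservedDensity W (flow c Y) h :=
      fun W Y hW hWU hY hTY =>
        (isConservedDensity_flow_iff hW (fun i j k => (hF.smooth_prod i j k).mono hWU) hY
          (hh.mono hWU) hTY).2 fun u hu a b => (hiff u (hWU hu)).1 (h2 u (hWU hu)) (Y u) a b
    exact ⟨fun k => hcons U (X k) hU subset_rfl (hX k) (hT k), fun W Y hW hWU hY =>
      hcons W Y hW hWU hY.1 fun u hu => (dMul_eq_zero_iff (hdiff hW hWU hY.1 u hu)
        (hΓ.torsionless u (hWU hu))).2 (hY.2 u hu)⟩
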